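/- A *dynamical system with double recursion* is a tuple $\mathfrak A=(A,f,0,1)$ consisting of a finite set $A$, a function $f:A\times A\to A$ and two elements $0,1\in A$. It is *symmetric* if $f(x,y)=f(y,x)$ for all $x,y\in A$. Its *development* is the function $a:\mathbb N\times\mathbb N\to A$ with $a(i,j)=1$ if $i=0$ or $j=0$, and $a(i,j)=f(a(i-1,j),a(i,j-1))$ if $i>0$ and $j>0$. The system is *ultimately zero* if there is an $N\in\mathbb N$ such that $a(i,j)=0$ for all $i,j>0$ with $i+j>N$. **Theorem.** The following two decision problems are not algorithmically solvable, where a system is given by the table of $f$ on $A=\{0,\dots,n-1\}$ (as a list of rows of numbers) together with the numbers of its elements $0$ and $1$: 1. (UW) Given a dynamical system with double recursion, tell if it is ultimately zero. 2. (SUW) Given a symmetric dynamical system with double recursion, tell if it is ultimately zero. That is, for neither problem is there an algorithm (partial recursive function) that halts on the description of every instance and answers correctly whether it is ultimately zero. -/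

import Mathlib

/-- A system `(A, f, 0, 1)` on the carrier `A`: a binary function, a white colour `0` and a start
symbol `1`. As in the usual definition, `0` and `1` are merely elements of `A`. -/
structure DoubleRecSystem (A : Type*) where
  f : A → A → A
  zero : A
  one : A

namespace DoubleRecSystem

/-- The development `a(i,j)`: it is `1` if `i = 0` or `j = 0`, and `f(a(i-1,j), a(i,j-1))`
otherwise. -/
def development {A : Type*} (S : DoubleRecSystem A) : ℕ → ℕ → A
  | 0, _ => S.one
  | _ + 1, 0 => S.one
  | i + 1, j + 1 => S.f (development S i (j + 1)) (development S (i + 1) j)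
termination_by i j => i + j

def IsSymmetric {A : Type*} (S : DoubleRecSystem A) : Prop :=
  ∀ x y : A, S.f x y = S.f y x

def UltimatelyZero {A : Type*} (S : DoubleRecSystem A) : Prop :=
  ∃ N : ℕ, ∀ i j : ℕ, 0 < i → 0 < j → N < i + j → S.development i j = S.zero

/-- Renaming the elements of the carrier along a bijection. -/
def rename {A B : Type*} (e : A ≃ B) (S : DoubleRecSystem A) : DoubleRecSystem B where
  f x y := e (S.f (e.symm x) (e.symm y))
  zero := e S.zero
  one := e S.one

theorem development_rename {A B : Type*} (e : A ≃ B) (S : DoubleRecSystem A) (i j : ℕ) :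
    (S.rename e).development i j = e (S.development i j) := by
  induction i generalizing j with
  | zero => simp [development, rename]
  | succ i ih =>
    induction j with
    | zero => simp [development, rename]
    | succ j ihj =>
      rw [development, development, ih, ihj]
      simp [rename]

/-- Being ultimately zero does not depend on the names of the elements, so that it is enough to
consider the carriers `{0, …, n-1}`. -/
theorem ultimatelyZero_rename {A B : Type*} (e : A ≃ B) (S : DoubleRecSystem A) :
    (S.rename e).UltimatelyZero ↔ S.UltimatelyZero := by
  have h : ∀ i j, (S.rename e).development i j = (S.rename e).zero ↔
      S.development i j = S.zero := fun i j => by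
    rw [development_rename]
    exact e.apply_eq_iff_eq
  simp only [UltimatelyZero, h]

end DoubleRecSystem

/-- The finite systems that can be given to an algorithm: a number `n` and a system on the
`n`-element set `{0, …, n-1}`. Every system on a finite set is a renaming of one of these. -/
abbrev FiniteDoubleRecSystem : Type := Σ n : ℕ, DoubleRecSystem (Fin n)

namespace FiniteDoubleRecSystem

/-- The input word that describes a finite system: the table of `f`, as the list of its rows, and
the numbers of the elements `0` and `1`. -/
def code (S : FiniteDoubleRecSystem) : List (List ℕ) × ℕ × ℕ :=
  (List.ofFn fun x => List.ofFn fun y => (S.2.f x y : ℕ), (S.2.zero : ℕ), (S.2.one : ℕ))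

/-- The code determines the system. -/
theorem code_injective : Function.Injective code := by
  rintro ⟨n, f, z, o⟩ ⟨m, g, z', o'⟩ h
  simp only [code, Prod.mk.injEq] at h
  obtain ⟨h1, h2, h3⟩ := h
  obtain rfl : n = m := by simpa using congrArg List.length h1
  have hz : z = z' := Fin.ext h2
  have ho : o = o' := Fin.ext h3
  have hf : f = g := by
    funext x y
    have h4 := congrFun (List.ofFn_injective h1) x
    exact Fin.ext (congrFun (List.ofFn_injective h4) y)
  rw [hz, ho, hf]

end FiniteDoubleRecSystem

/-- A decision problem with instances `x : I`, question `P x`, and inputs `code x`, is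
algorithmically solvable if some algorithm (a partial recursive function) halts with the correct
yes-or-no answer on the code of each instance. Nothing is required on inputs that do not code
an instance. -/
def AlgorithmicallySolvable {I α : Type*} [Primcodable α] (code : I → α) (P : I → Prop) : Prop :=
  ∃ d : α →. Bool, Partrec d ∧ ∀ x : I, ∃ b : Bool, b ∈ d (code x) ∧ (b = true ↔ P x)

/-- The problem UW: given a finite system, tell if it is ultimately zero. -/
def UWSolvable : Prop :=
  AlgorithmicallySolvable FiniteDoubleRecSystem.code fun S => S.2.UltimatelyZero

/-- The problem SUW: given a symmetric finite system, tell if it is ultimately zero. -/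
def SUWSolvable : Prop :=
  AlgorithmicallySolvable
    (fun S : {S : FiniteDoubleRecSystem // S.2.IsSymmetric} => FiniteDoubleRecSystem.code S.1)
    fun S => S.1.2.UltimatelyZero

/-!
Since every symmetric system is a system, an algorithm for UW is also one for SUW, so it is enough
to refute the latter. The halting problem is reduced to SUW.

**The source problem.** Fix a `ToPartrec.Code` that on input `2 ^ k` runs the `k`-th partial
recursive function on `0`. Mathlib compiles it to a Turing machine `M` in the `TM0` model with
finitely many states. The binary expansion of `2 ^ k` being a run of zeros and a one, the input tape
has the form `a, b, c, …, c` with `k` letters `c`, and halting of `M` on these tapes is undecidable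
in `k` (`exists_TM0_undecidable`).

**The simulation.** The half `i ≤ j` of a symmetric development determines all of it. Its column
`t + 1`, read upwards from the diagonal, is a finite word followed by zeros, and it represents the
configuration of `M` after `t` steps: the state and the scanned letter come next to the diagonal,
then the cells of the tape, folded at the head, so that cell `i` holds the `i`-th letter to the left
of the head and the `i`-th to the right. The recursion `a(i,j) = f(a(i-1,j), a(i,j-1))` computes a
column by a sequential pass over the preceding one, with the entry computed last as the memory of
the pass. As the diagonal moves up by one in each column, this pass sees the cells one place ahead
of the place it writes to, and that is enough to shift either half of the tape by one cell in
either direction. Because `f` is symmetric, it has to recognize which argument is the old entry and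
which is the memory; each entry carries the number of its column modulo three for this purpose. The
words grow by one cell per step. When `M` halts, a column of `kill` symbols is produced, and
everything after it is zero. So the development is ultimately zero if and only if `M` halts
(`GridSymbol.system_ultimatelyZero_iff`).

**The initial column.** It must spell out the tape with the `k` letters `c`; the pass along the
constant column of `1`s is driven by `k + 3` additional symbols that count. Only this part of the
table of `f` depends on `k`, and it does so in a primitive recursive way
(`GridSymbol.primrec_code`).
-/

open Turing

/-! ### Halting of a fixed Turing machine on tapes given by a number -/

/-- Powers of two are used as inputs because their binary expansions, which Mathlib's compiled
machine reads, are as simple as a unary notation. -/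
theorem trNat_two_pow (k : ℕ) : PartrecToTM2.trNat (2 ^ k) =
    List.replicate k PartrecToTM2.Γ'.bit0 ++ [PartrecToTM2.Γ'.bit1] := by
  have key : ∃ p : PosNum, ((2 ^ k : ℕ) : Num) = Num.pos p ∧ PartrecToTM2.trPosNum p =
      List.replicate k PartrecToTM2.Γ'.bit0 ++ [PartrecToTM2.Γ'.bit1] := by
    induction k with
    | zero => exact ⟨1, rfl, rfl⟩
    | succ k ih =>
      obtain ⟨p, hp, hl⟩ := ih
      refine ⟨p.bit0, ?_, ?_⟩
      · rw [pow_succ, mul_two, Nat.cast_add, hp]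
        exact congrArg Num.pos (PosNum.bit0_of_bit0 p)
      · rw [PartrecToTM2.trPosNum, hl, List.replicate_succ, List.cons_append]
  obtain ⟨p, hp, hl⟩ := key
  rw [PartrecToTM2.trNat, hp, PartrecToTM2.trNum, hl]

/-- The partial logarithm, defined exactly on the powers of two, is partial recursive. -/
theorem partrec_two_pow_inv : Partrec fun m : ℕ =>
    Nat.rfind fun k => Part.some (decide (2 ^ k = m)) := by
  have hpow : Primrec fun k : ℕ => 2 ^ k :=
    (Primrec.nat_rec₁ 1 (Primrec.nat_mul.comp₂ Primrec₂.right (Primrec₂.const 2))).of_eq fun k => by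
      induction k with
      | zero => rfl
      | succ k ih => simp only [ih, pow_succ]
  refine Partrec.rfind (p := fun m k => Part.some (decide (2 ^ k = m))) ?_
  have : PrimrecRel fun m k : ℕ => 2 ^ k = m :=
    Primrec.eq.comp₂ (hpow.comp₂ Primrec₂.right) Primrec₂.left
  exact this.decide.to_comp

/-- A universal program that is given its argument as the exponent of a power of two. -/
theorem exists_code_undecidable : ∃ c : ToPartrec.Code, ¬ ComputablePred fun k : ℕ =>
    (c.eval [2 ^ k]).Dom := by
  have hf : Partrec fun m : ℕ => (Nat.rfind fun k => Part.some (decide (2 ^ k = m))).bind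
      fun k => (Denumerable.ofNat Nat.Partrec.Code k).eval 0 :=
    partrec_two_pow_inv.bind
      (Nat.Partrec.Code.eval_part.comp ((Computable.ofNat _).comp Computable.snd)
        (Computable.const 0))
  obtain ⟨c, hc⟩ := ToPartrec.Code.exists_code (Nat.Partrec'.part_iff₁.2 hf)
  refine ⟨c, fun h => ComputablePred.halting_problem 0 ?_⟩
  have hr : ∀ k, Nat.rfind (fun j => Part.some (decide (2 ^ j = 2 ^ k))) = Part.some k := by
    intro k
    refine Part.eq_some_iff.2 (Nat.mem_rfind.2 ⟨by simp, fun {j} hj => ?_⟩)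
    simpa using hj.ne
  have hd : ∀ k, (c.eval [2 ^ k]).Dom ↔ ((Denumerable.ofNat Nat.Partrec.Code k).eval 0).Dom := by
    intro k
    have := hc ⟨[2 ^ k], rfl⟩
    simp only at this
    rw [this]
    change (Part.map _ ((Nat.rfind fun j => Part.some (decide (2 ^ j = 2 ^ k))).bind _)).Dom ↔ _
    rw [hr, Part.bind_some]
    rfl
  refine ComputablePred.of_eq (ComputablePred.computable_iff.2 ?_)
    (p := fun x : Nat.Partrec.Code => (c.eval [2 ^ Encodable.encode x]).Dom) ?_
  · obtain ⟨f, hf, he⟩ := ComputablePred.computable_iff.1 h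
    exact ⟨fun x => f (Encodable.encode x), hf.comp Computable.encode,
      funext fun x => congrFun he _⟩
  · intro x
    rw [hd, Denumerable.ofNat_encode]

/-- A Turing machine whose halting on the tapes `a, b, c, …, c` is undecidable. The type of states
of Mathlib's compiled machine is infinite, but a finite set `S` of states is closed under its steps.
-/
theorem exists_TM0_undecidable : ∃ (Γ Λ : Type) (_ : Inhabited Γ) (_ : Inhabited Λ) (_ : Finite Γ)
    (M : TM0.Machine Γ Λ) (S : Finset Λ) (a b c : Γ), TM0.Supports M (S : Set Λ) ∧
    ¬ ComputablePred fun k : ℕ => (TM0.eval M (a :: b :: List.replicate k c)).Dom := by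
  obtain ⟨c, hc⟩ := exists_code_undecidable
  have : Finite PartrecToTM2.K' := Finite.of_surjective
    (![PartrecToTM2.K'.main, .rev, .aux, .stack]) (by
      rintro (_ | _ | _ | _)
      exacts [⟨0, rfl⟩, ⟨1, rfl⟩, ⟨2, rfl⟩, ⟨3, rfl⟩])
  let _ : Fintype PartrecToTM2.K' := Fintype.ofFinite _
  -- The default label is the initial one, so it has to be chosen according to the program.
  let _ : Inhabited PartrecToTM2.Λ' := ⟨PartrecToTM2.trNormal c .halt⟩
  have h₂ := PartrecToTM2.tr_supports c .halt
  have h₁ := TM2to1.tr_supports _ h₂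
  have h₀ := TM1to0.tr_supports _ h₁
  let s (x : PartrecToTM2.Γ') : PartrecToTM2.K' → Option PartrecToTM2.Γ' :=
    Function.update (fun _ => none) .main (some x)
  refine ⟨TM2to1.Γ' PartrecToTM2.K' fun _ => PartrecToTM2.Γ',
    TM1to0.Λ' (TM2to1.tr PartrecToTM2.tr), inferInstance, inferInstance, inferInstance,
    TM1to0.tr (TM2to1.tr PartrecToTM2.tr), _, (true, s .cons), (false, s .bit1), (false, s .bit0),
    h₀, fun h => hc (h.of_eq fun k => ?_)⟩
  -- The bottom of the stack, which is the end of the input, is the start of the tape.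
  have hi : TM2to1.trInit (Γ := fun _ => PartrecToTM2.Γ') PartrecToTM2.K'.main
      (PartrecToTM2.trList [2 ^ k]) =
      (true, s .cons) :: (false, s .bit1) :: List.replicate k (false, s .bit0) := by
    have hr : (PartrecToTM2.trList [2 ^ k]).reverse =
        .cons :: .bit1 :: List.replicate k PartrecToTM2.Γ'.bit0 := by
      simp [PartrecToTM2.trList, trNat_two_pow]
    unfold TM2to1.trInit
    rw [hr]
    exact congrArg (fun t => (true, s .cons) :: (false, s .bit1) :: t) List.map_replicate
  have hinit : TM2.init PartrecToTM2.K'.main (PartrecToTM2.trList [2 ^ k]) =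
      PartrecToTM2.init c [2 ^ k] := by
    simp only [TM2.init, PartrecToTM2.init]
    congr 1
    funext x
    cases x <;> rfl
  refine (iff_of_eq (congrArg Part.Dom (TM1to0.tr_eval _ _))).trans ?_
  refine (iff_of_eq (congrArg (fun l => (TM1.eval _ l).Dom) hi.symm)).trans ?_
  refine (TM2to1.tr_eval_dom (M := PartrecToTM2.tr) .main _).trans ?_
  have := congrArg Part.Dom (PartrecToTM2.tr_eval c [2 ^ k])
  rw [← hinit] at this
  exact iff_of_eq this

/-- A machine supported by a finite set of states can be restricted to that set. -/
theorem Turing.TM0.exists_finite_machine {Γ Λ : Type} [Inhabited Γ] [Inhabited Λ]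
    (M : TM0.Machine Γ Λ) (S : Finset Λ) (hS : TM0.Supports M (S : Set Λ)) :
    ∃ (Λ' : Type) (_ : Inhabited Λ') (_ : Finite Λ') (M' : TM0.Machine Γ Λ'),
      ∀ l, (TM0.eval M' l).Dom ↔ (TM0.eval M l).Dom := by
  classical
  let _ : Inhabited S := ⟨⟨default, hS.1⟩⟩
  let g : PointedMap Λ S := ⟨fun q => if h : q ∈ S then ⟨q, h⟩ else default, by
    exact dif_pos (Finset.mem_coe.1 hS.1)⟩
  have hg : ∀ q ∈ (S : Set Λ), (g.f q : Λ) = q := fun q hq => by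
    simp only [g, dif_pos (Finset.mem_coe.1 hq)]
  have hid : Function.RightInverse (⟨id, rfl⟩ : PointedMap Γ Γ).f (⟨id, rfl⟩ : PointedMap Γ Γ).f :=
    fun _ => rfl
  refine ⟨S, inferInstance, inferInstance, M.map ⟨id, rfl⟩ ⟨id, rfl⟩ g.f Subtype.val, fun l => ?_⟩
  have h := StateTransition.tr_eval_dom (M.map_respects ⟨id, rfl⟩ ⟨id, rfl⟩ g _ hS hid hg)
    (a₁ := TM0.init l) ⟨hS.1, rfl⟩
  rw [TM0.map_init, show l.map (⟨id, rfl⟩ : PointedMap Γ Γ) = l from List.map_id l] at h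
  exact h

/-! ### Homomorphisms of systems, and symmetric developments -/

namespace DoubleRecSystem

theorem IsSymmetric.development_comm {A : Type*} {S : DoubleRecSystem A} (hS : S.IsSymmetric)
    (i j : ℕ) : S.development i j = S.development j i := by
  induction i generalizing j with
  | zero => cases j <;> simp [development]
  | succ i ih =>
    induction j with
    | zero => simp [development]
    | succ j ihj => rw [development, development, ih, ihj, hS]

/-- A homomorphism of systems maps developments to developments. -/
theorem development_hom {A B : Type*} {S : DoubleRecSystem A} {T : DoubleRecSystem B} (φ : A → B)
    (hone : φ S.one = T.one) (hf : ∀ x y, φ (S.f x y) = T.f (φ x) (φ y)) (i j : ℕ) :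
    T.development i j = φ (S.development i j) := by
  induction i generalizing j with
  | zero => simp [development, hone]
  | succ i ih =>
    induction j with
    | zero => simp [development, hone]
    | succ j ihj => rw [development, development, ih, ihj, hf]

theorem ultimatelyZero_hom {A B : Type*} {S : DoubleRecSystem A} {T : DoubleRecSystem B}
    (φ : A → B) (hφ : Function.Injective φ) (hzero : φ S.zero = T.zero) (hone : φ S.one = T.one)
    (hf : ∀ x y, φ (S.f x y) = T.f (φ x) (φ y)) : T.UltimatelyZero ↔ S.UltimatelyZero := by
  simp only [UltimatelyZero, development_hom φ hone hf, ← hzero, hφ.eq_iff]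

end DoubleRecSystem

/-! ### The symbols and the symmetric transition rule -/

/-- The fixed part of the carrier of the simulating system, for a machine with alphabet `Γ` and
states `Λ`. The entry `c : ZMod 3` is the number of the column; `op` is the action of the machine
that is being carried out on its way up the column, with `none` for writing; a pair in `Γ × Γ` is a
cell of the folded tape, with the letter of the left half first.

* `kill` fills the column after a halting configuration.
* `corner` is the entry on the diagonal: the new state `q`, the action, the letter `a` to be written
  (if any) and the letter `h` that was scanned before.
* `head` is the entry above it: the state `q` and the scanned letter `h`.
* `cell` is an entry of the folded tape with content `x`. Its mark `fl` is `3` at the top of the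
  word, `1` and `2` at the two places below it, and `0` elsewhere; in the initial column only `0`
  and `3` occur.

In the last two cases `u`, `v` are the last two cells that were read in the preceding column, where
the pair `(h, h)` of the letter scanned before counts as the first one; in the initial column they
are arbitrary. The symbol `one` occurs only on the boundary of the development. -/
inductive GridSymbol (Γ Λ : Type)
  | zero
  | one
  | kill
  | corner (c : ZMod 3) (q : Λ) (op : Option Dir) (a h : Γ)
  | head (c : ZMod 3) (q : Λ) (h : Γ) (op : Option Dir) (u v : Γ × Γ)
  | cell (c : ZMod 3) (op : Option Dir) (u v x : Γ × Γ) (fl : Fin 4)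

namespace GridSymbol

section transition

variable {Γ Λ : Type}

instance [Finite Γ] [Finite Λ] : Finite (GridSymbol Γ Λ) := by
  have : Finite Dir := Finite.of_surjective (fun b : Bool => if b then Dir.left else Dir.right) (by
    rintro (_ | _)
    exacts [⟨true, rfl⟩, ⟨false, rfl⟩])
  let F : Fin 3 ⊕ (ZMod 3 × Λ × Option Dir × Γ × Γ) ⊕
      (ZMod 3 × Λ × Γ × Option Dir × (Γ × Γ) × (Γ × Γ)) ⊕
      (ZMod 3 × Option Dir × (Γ × Γ) × (Γ × Γ) × (Γ × Γ) × Fin 4) → GridSymbol Γ Λ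
    | .inl i => ![zero, one, kill] i
    | .inr (.inl (c, q, op, a, h)) => corner c q op a h
    | .inr (.inr (.inl (c, q, h, op, u, v))) => head c q h op u v
    | .inr (.inr (.inr (c, op, u, v, x, fl))) => cell c op u v x fl
  refine Finite.of_surjective F ?_
  rintro (_ | _ | _ | _ | _ | _)
  exacts [⟨.inl 0, rfl⟩, ⟨.inl 1, rfl⟩, ⟨.inl 2, rfl⟩, ⟨.inr (.inl (_, _, _, _, _)), rfl⟩,
    ⟨.inr (.inr (.inl (_, _, _, _, _, _))), rfl⟩, ⟨.inr (.inr (.inr (_, _, _, _, _, _))), rfl⟩]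

/-- The new content of a cell of the folded tape whose old content is `v`, where `u` and `w` are the
old contents of the cell before it and the cell after it. -/
def newCell : Option Dir → Γ × Γ → Γ × Γ → Γ × Γ → Γ × Γ
  | some .right, u, _, w => (u.1, w.2)
  | some .left, u, _, w => (w.1, u.2)
  | none, _, v, _ => v

/-- The letter scanned after an action, where `a` is the letter to be written and `x` the first cell
of the folded tape. -/
def newHead : Option Dir → Γ → Γ × Γ → Γ
  | some .right, _, x => x.2
  | some .left, _, x => x.1
  | none, a, _ => a

variable [Inhabited Γ]

/-- The pass over a column: `next x y` is the entry computed from the entry `x` of the preceding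
column and the entry `y` below, if this is a situation that arises in the simulation with the
arguments in this order. Beyond the top of the preceding column, where `x` is `zero`, the marks `1`,
`2`, `3` make the pass write two more cells and then stop. -/
def next : GridSymbol Γ Λ → GridSymbol Γ Λ → Option (GridSymbol Γ Λ)
  | cell c' _ _ _ x _, corner c q op a h =>
    if c = c' + 1 then some (head c q (newHead op a x) op (h, h) x) else none
  | cell c' _ _ _ x fl', head c _ _ op u v =>
    if c = c' + 1 then some (cell c op v x (newCell op u v x) (if fl' = 3 then 1 else 0)) else none
  | cell c' _ _ _ x fl', cell c op u v _ fl =>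
    if c = c' + 1 ∧ fl = 0 then
      some (cell c op v x (newCell op u v x) (if fl' = 3 then 1 else 0)) else none
  | cell _ _ _ _ _ _, kill => some kill
  | zero, cell c op u v _ fl =>
    if fl = 1 then some (cell c op v default (newCell op u v default) 2)
    else if fl = 2 then some (cell c op v default (newCell op u v default) 3)
    else none
  | _, _ => none

/-- The symbol `one` stays confined to the boundary of the development. -/
theorem next_ne_one (x y : GridSymbol Γ Λ) : next x y ≠ some one := by
  unfold next
  split <;> (try split_ifs) <;> simp

/-- The `i`-th cell of the tape folded at the head. -/
def sides (T : Tape Γ) (i : ℕ) : Γ × Γ := (T.left.nth i, T.right.nth i)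

/-- The word `w`, a column read upwards from the diagonal, represents the configuration `cfg` with
cells `0, …, E` of the folded tape, the remaining ones being blank. Nothing is required of `w 0`. -/
structure Represents (c : ZMod 3) (cfg : TM0.Cfg Γ Λ) (w : ℕ → GridSymbol Γ Λ) (E : ℕ) : Prop where
  pos : 1 ≤ E
  head : ∃ op u v, w 1 = .head c cfg.q cfg.Tape.head op u v
  cell : ∀ i ≤ E, ∃ op u v fl, w (i + 2) = .cell c op u v (sides cfg.Tape i) fl ∧
    (fl = 3 ↔ i = E)
  blank : ∀ i, E < i → w (i + 2) = .zero ∧ sides cfg.Tape i = default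

theorem Represents.eventually_zero {x : ZMod 3} {cfg : TM0.Cfg Γ Λ} {w : ℕ → GridSymbol Γ Λ}
    {E : ℕ} (H : Represents x cfg w E) : ∃ B, ∀ m, B ≤ m → w m = zero :=
  ⟨E + 3, fun m hm => by
    obtain ⟨i, rfl⟩ : ∃ i, m = i + 2 := ⟨m - 2, by omega⟩
    exact (H.blank i (by omega)).1⟩

variable [Inhabited Λ] (M : TM0.Machine Γ Λ)

/-- The entry on the diagonal, where the two arguments coincide: the machine looks up its table.
After a column of `kill` symbols it is zero. -/
def diag : GridSymbol Γ Λ → GridSymbol Γ Λ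
  | head c q h _ _ _ =>
    match M q h with
    | none => kill
    | some (q', .move d) => corner (c + 1) q' (some d) default h
    | some (q', .write a) => corner (c + 1) q' none a h
  | _ => zero

open scoped Classical in
/-- The transition rule. Off the diagonal it applies `next` with its arguments in whichever order
makes sense, and so is symmetric by construction. -/
noncomputable def rule (x y : GridSymbol Γ Λ) : GridSymbol Γ Λ :=
  if x = y then diag M x
  else match next x y, next y x with
    | some z, none => z
    | none, some z => z
    | _, _ => zero

theorem rule_comm (x y : GridSymbol Γ Λ) : rule M x y = rule M y x := by
  unfold rule
  by_cases h : x = y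
  · rw [h]
  · rw [if_neg h, if_neg (Ne.symm h)]
    cases next x y <;> cases next y x <;> rfl

theorem rule_self (x : GridSymbol Γ Λ) : rule M x x = diag M x := if_pos rfl

theorem rule_eq {x y z : GridSymbol Γ Λ} (h₁ : next x y = some z) (h₂ : next y x = none) :
    rule M x y = z := by
  rw [rule, if_neg, h₁, h₂]
  rintro rfl
  simp [h₁] at h₂

theorem rule_eq_zero {x y : GridSymbol Γ Λ} (hne : x ≠ y) (h₁ : next x y = none)
    (h₂ : next y x = none) :
    rule M x y = zero := by
  rw [rule, if_neg hne, h₁, h₂]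

theorem rule_ne_one (x y : GridSymbol Γ Λ) : rule M x y ≠ one := by
  unfold rule
  split_ifs with h
  · unfold diag
    split
    · split <;> simp
    · simp
  · split
    · rename_i h1 _
      rintro rfl
      exact next_ne_one _ _ h1
    · rename_i h1
      rintro rfl
      exact next_ne_one _ _ h1
    · simp

theorem rule_zero_zero : rule M (zero : GridSymbol Γ Λ) zero = zero := rule_self M _

variable {M}

/-- The cells of the folded tape preceded by the scanned letter in both halves, so that moving the
head shifts it into either half like any other letter. -/
def before (T : Tape Γ) : ℕ → Γ × Γ
  | 0 => (T.head, T.head)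
  | i + 1 => sides T i

/-- This is where two colours would not do: the old entry must not look like a memory for the new
one. -/
theorem zmod_three_ne (c : ZMod 3) : c ≠ c + 1 + 1 := by revert c; decide

/-- Once an entry above the end of the preceding column is zero, all entries above it are. -/
theorem eq_zero_of_le {w w' : ℕ → GridSymbol Γ Λ} (h : ∀ m, w' (m + 1) = rule M (w (m + 2)) (w' m))
    {B : ℕ} (hw : ∀ m, B ≤ m → w (m + 2) = zero) (hB : w' B = zero) :
    ∀ m, B ≤ m → w' m = zero := by
  intro m hm
  induction m, hm using Nat.le_induction with
  | base => exact hB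
  | succ m hm ih => rw [h, hw m hm, ih, rule_zero_zero]

section column
variable {c : ZMod 3} {cfg : TM0.Cfg Γ Λ} {w w' : ℕ → GridSymbol Γ Λ} {E : ℕ}

/-- The entries of the column after one that represents a configuration which is not halting. -/
theorem column_step (H : Represents c cfg w E) {q : Λ} {op : Option Dir} {a : Γ}
    (h0 : w' 0 = corner (c + 1) q op a cfg.Tape.head)
    (h : ∀ m, w' (m + 1) = rule M (w (m + 2)) (w' m)) :
    w' 1 = .head (c + 1) q (newHead op a (sides cfg.Tape 0)) op
      (before cfg.Tape 0) (before cfg.Tape 1) ∧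
    (∀ i ≤ E + 1, w' (i + 2) = .cell (c + 1) op (before cfg.Tape (i + 1)) (before cfg.Tape (i + 2))
      (newCell op (before cfg.Tape i) (before cfg.Tape (i + 1)) (before cfg.Tape (i + 2)))
      (if i + 1 < E then 0 else if i + 1 = E then 1 else if i = E then 2 else 3)) ∧
    ∀ i, E + 1 < i → w' (i + 2) = zero := by
  have hc := zmod_three_ne c
  have h1 : w' 1 = .head (c + 1) q (newHead op a (sides cfg.Tape 0)) op
      (before cfg.Tape 0) (before cfg.Tape 1) := by
    obtain ⟨_, _, _, _, hw, _⟩ := H.cell 0 (Nat.zero_le _)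
    rw [h, hw, h0]
    exact rule_eq M (by simp [next, before]) (by simp [next])
  have h2 : ∀ i ≤ E + 1, w' (i + 2) = .cell (c + 1) op (before cfg.Tape (i + 1))
      (before cfg.Tape (i + 2))
      (newCell op (before cfg.Tape i) (before cfg.Tape (i + 1)) (before cfg.Tape (i + 2)))
      (if i + 1 < E then 0 else if i + 1 = E then 1 else if i = E then 2 else 3) := by
    intro i
    induction i with
    | zero =>
      intro _
      obtain ⟨_, _, _, fl, hw, hfl⟩ := H.cell 1 H.pos
      rw [h, hw, h1]
      refine rule_eq M ?_ (by simp [next])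
      have := H.pos
      rcases Nat.lt_or_ge 1 E with hE | hE
      · simp [next, before, hfl, hE, hE.ne]
      · obtain rfl : E = 1 := by omega
        simp [next, before, hfl]
    | succ i ih =>
      intro hi
      rw [h, ih (by omega)]
      rcases Nat.lt_or_ge E (i + 2) with hE | hE
      · obtain ⟨hz, hs⟩ := H.blank (i + 2) hE
        rw [hz]
        refine rule_eq M ?_ (by simp [next])
        rcases Nat.lt_or_ge i E with hi' | hi'
        · obtain rfl : E = i + 1 := by omega
          simp [next, before, hs]
        · obtain rfl : E = i := by omega
          simp [next, before, hs, show ¬ E + 1 + 1 < E by omega, show E + 1 + 1 ≠ E by omega]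
      · obtain ⟨_, _, _, fl, hw, hfl⟩ := H.cell (i + 2) hE
        rw [hw, if_pos (by omega)]
        refine rule_eq M ?_ (by simp [next, hc])
        rcases Nat.lt_or_ge (i + 2) E with hE' | hE'
        · simp [next, before, hfl, hE', hE'.ne]
        · obtain rfl : E = i + 2 := by omega
          simp [next, before, hfl]
  refine ⟨h1, h2, fun i hi => ?_⟩
  obtain ⟨m, rfl⟩ : ∃ m, i = m + (E + 2) := ⟨i - (E + 2), by omega⟩
  refine eq_zero_of_le h (B := E + 4) (fun m hm => ?_) ?_ _ (by omega)
  · exact (H.blank m (by omega)).1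
  · rw [h, (H.blank (E + 3) (by omega)).1, h2 (E + 1) le_rfl,
      if_neg (by omega), if_neg (by omega), if_neg (by omega)]
    exact rule_eq_zero M (by simp) (by simp [next]) (by simp [next])

theorem Represents.step (H : Represents c cfg w E) {cfg' : TM0.Cfg Γ Λ}
    (hs : TM0.step M cfg = some cfg') (h0 : w' 0 = diag M (w 1))
    (h : ∀ m, w' (m + 1) = rule M (w (m + 2)) (w' m)) : Represents (c + 1) cfg' w' (E + 1) := by
  obtain ⟨q, T⟩ := cfg
  obtain ⟨_, _, _, h1⟩ := H.head
  rw [h1, diag] at h0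
  simp only [TM0.step, Option.map_eq_some_iff] at hs
  obtain ⟨⟨q', s⟩, hM, rfl⟩ := hs
  simp only [hM] at h0
  have key : ∀ (op : Option Dir) (a : Γ) (T' : Tape Γ),
      w' 0 = corner (c + 1) q' op a T.head → T'.head = newHead op a (sides T 0) →
      (∀ i, sides T' i = newCell op (before T i) (before T (i + 1)) (before T (i + 2))) →
      Represents (c + 1) ⟨q', T'⟩ w' (E + 1) := by
    intro op a T' h0 hh hT
    obtain ⟨k1, k2, k3⟩ := column_step H h0 h
    refine ⟨by omega, ⟨_, _, _, by rw [k1, hh]⟩, fun i hi => ⟨_, _, _, _, by rw [k2 i hi, hT], ?_⟩,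
      fun i hi => ⟨k3 i hi, ?_⟩⟩
    · split_ifs <;> simp <;> omega
    · have hb : ∀ j, i ≤ j → before T j = default := by
        intro j hj
        obtain ⟨j, rfl⟩ : ∃ m, j = m + 1 := ⟨j - 1, by omega⟩
        exact (H.blank j (by omega)).2
      change sides T' i = default
      rw [hT, hb i le_rfl, hb (i + 1) (by omega), hb (i + 2) (by omega)]
      rcases op with _ | _ | _ <;> rfl
  rcases s with d | a
  · refine key (some d) default _ h0 ?_ ?_
    · cases d <;> simp [Tape.move, newHead, sides]
    · intro i
      cases d <;> cases i <;> simp [Tape.move, newCell, sides, before]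
  · exact key none a _ h0 rfl fun i => rfl

theorem Represents.halt (H : Represents c cfg w E)
    (hs : TM0.step M cfg = none) (h0 : w' 0 = diag M (w 1))
    (h : ∀ m, w' (m + 1) = rule M (w (m + 2)) (w' m)) :
    (∀ m ≤ E + 1, w' m = kill) ∧ ∀ m, E + 1 < m → w' m = zero := by
  have hk : ∀ m ≤ E + 1, w' m = kill := by
    intro m
    induction m with
    | zero =>
      intro _
      obtain ⟨_, _, _, h1⟩ := H.head
      simp only [TM0.step, Option.map_eq_none_iff] at hs
      rw [h0, h1, diag]
      simp [hs]
    | succ m ih =>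
      intro hm
      obtain ⟨_, _, _, _, hw, _⟩ := H.cell m (by omega)
      rw [h, ih (by omega), hw]
      exact rule_eq M (by simp [next]) (by simp [next])
  refine ⟨hk, fun m hm => eq_zero_of_le h (B := E + 2) (fun m hm => ?_) ?_ m hm⟩
  · exact (H.blank m (by omega)).1
  · rw [h, (H.blank (E + 1) (by omega)).1, hk _ le_rfl]
    exact rule_eq_zero M (by simp) (by simp [next]) (by simp [next])

end column

end transition

/-! ### The development of the simulating system -/

section development

variable {Γ Λ : Type} [Inhabited Γ]

/-- The initial column, in which each entry is determined by the one below. -/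
def chain (k : ℕ) : GridSymbol Γ Λ ⊕ ℕ → GridSymbol Γ Λ ⊕ ℕ
  | .inl _ => .inl zero
  | .inr i => if i < k + 2 then .inr (i + 1) else .inl (cell 1 none default default default 3)

theorem chain_ne_one {k : ℕ} (u : GridSymbol Γ Λ ⊕ ℕ) : chain k u ≠ .inl one := by
  unfold chain
  split
  · simp
  · split_ifs <;> simp

variable [Inhabited Λ]

/-- The symbols that the counting symbols of the initial column stand for; together they represent
the initial configuration on the tape `a, b, c, …, c`. The symbol number `0` is on the diagonal,
where it is never looked at again. -/
def start (a b c : Γ) : ℕ → GridSymbol Γ Λ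
  | 0 => one
  | 1 => head 1 default a none default default
  | 2 => cell 1 none default default (default, b) 0
  | _ + 3 => cell 1 none default default (default, c) 0

/-- Replaces each counting symbol by the symbol it stands for. -/
def proj (a b c : Γ) : GridSymbol Γ Λ ⊕ ℕ → GridSymbol Γ Λ :=
  Sum.elim id (start a b c)

open scoped Classical in
/-- The function of the simulating system on the tape with `k` letters `c`. The carrier has
infinitely many counting symbols `Sum.inr i`, which makes it independent of `k`; only those with `i
< k + 3` occur as values. -/
noncomputable def table (M : TM0.Machine Γ Λ) (a b c : Γ) (k : ℕ) (u v : GridSymbol Γ Λ ⊕ ℕ) :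
    GridSymbol Γ Λ ⊕ ℕ :=
  if u = .inl one then (if v = .inl one then .inr 0 else chain k v)
  else if v = .inl one then chain k u
  else .inl (rule M (proj a b c u) (proj a b c v))

/-- The simulating system, on an infinite carrier. -/
noncomputable def system (M : TM0.Machine Γ Λ) (a b c : Γ) (k : ℕ) :
    DoubleRecSystem (GridSymbol Γ Λ ⊕ ℕ) where
  f := table M a b c k
  zero := .inl zero
  one := .inl one

variable {M : TM0.Machine Γ Λ} {a b c : Γ} {k : ℕ}

theorem table_comm (u v : GridSymbol Γ Λ ⊕ ℕ) : table M a b c k u v = table M a b c k v u := by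
  unfold table
  split_ifs with h1 h2
  · rfl
  · rfl
  · rfl
  · rw [rule_comm]

theorem table_ne_one (u v : GridSymbol Γ Λ ⊕ ℕ) : table M a b c k u v ≠ .inl one := by
  unfold table
  split_ifs
  · simp
  · exact chain_ne_one _
  · exact chain_ne_one _
  · simpa using rule_ne_one M _ _

theorem proj_eq_zero {u : GridSymbol Γ Λ ⊕ ℕ} : proj a b c u = zero ↔ u = .inl zero := by
  rcases u with u | _ | _ | _ | i <;> simp [proj, start]

/-- The column `t + 1` of the development, read upwards from the diagonal. -/
noncomputable def column (M : TM0.Machine Γ Λ) (a b c : Γ) (k t m : ℕ) : GridSymbol Γ Λ :=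
  proj a b c ((system M a b c k).development (t + 1) (t + 1 + m))

theorem development_succ_ne_one (i j : ℕ) :
    (system M a b c k).development (i + 1) (j + 1) ≠ .inl one := by
  rw [DoubleRecSystem.development]
  exact table_ne_one _ _

/-- Away from the boundary, the counting symbols behave like the symbols they stand for. -/
theorem proj_development (i j : ℕ) :
    proj a b c ((system M a b c k).development (i + 2) (j + 2)) =
      rule M (proj a b c ((system M a b c k).development (i + 1) (j + 2)))
        (proj a b c ((system M a b c k).development (i + 2) (j + 1))) := by
  rw [DoubleRecSystem.development]
  simp only [system, table]
  rw [if_neg, if_neg]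
  · rfl
  · exact development_succ_ne_one _ _
  · exact development_succ_ne_one _ _

theorem column_succ_zero (t : ℕ) :
    column M a b c k (t + 1) 0 = diag M (column M a b c k t 1) := by
  have hS : (system M a b c k).IsSymmetric := fun u v => table_comm u v
  unfold column
  rw [← rule_self, add_zero, proj_development, hS.development_comm (t + 2) (t + 1)]

theorem column_succ_succ (t m : ℕ) : column M a b c k (t + 1) (m + 1) =
    rule M (column M a b c k t (m + 2)) (column M a b c k (t + 1) m) := by
  unfold column
  rw [show t + 1 + 1 + (m + 1) = t + m + 1 + 2 by ring, proj_development,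
    show t + 1 + (m + 2) = t + m + 1 + 2 by ring, show t + 1 + 1 + m = t + m + 1 + 1 by ring]

theorem development_one_succ (j : ℕ) : (system M a b c k).development 1 (j + 2) =
    chain k ((system M a b c k).development 1 (j + 1)) := by
  rw [DoubleRecSystem.development, DoubleRecSystem.development]
  simp only [system, table]
  rw [if_pos trivial]
  exact if_neg (development_succ_ne_one 0 j)

theorem development_one (i : ℕ) (hi : i ≤ k + 2) :
    (system M a b c k).development 1 (i + 1) = .inr i := by
  induction i with
  | zero =>
    rw [DoubleRecSystem.development, DoubleRecSystem.development, DoubleRecSystem.development]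
    simp [system, table]
  | succ i ih => rw [development_one_succ, ih (by omega), chain, if_pos (by omega)]

theorem column_zero_of_le (m : ℕ) (hm : m ≤ k + 2) : column M a b c k 0 m = start a b c m := by
  rw [column, zero_add, add_comm 1, development_one m hm]
  rfl

theorem development_one_last : (system M a b c k).development 1 (k + 4) =
    .inl (cell 1 none default default default 3) := by
  rw [development_one_succ, development_one _ le_rfl, chain, if_neg (lt_irrefl _)]

theorem column_zero_last : column M a b c k 0 (k + 3) = cell 1 none default default default 3 := by
  rw [column, zero_add, show 1 + (k + 3) = k + 4 by ring, development_one_last]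
  rfl

theorem column_zero_of_gt (m : ℕ) : column M a b c k 0 (m + (k + 4)) = zero := by
  rw [column, zero_add, proj_eq_zero, show 1 + (m + (k + 4)) = m + k + 3 + 2 by ring]
  induction m with
  | zero =>
    rw [development_one_succ, show 0 + k + 3 + 1 = k + 4 by ring, development_one_last, chain]
  | succ m ih =>
    rw [development_one_succ, show m + 1 + k + 3 + 1 = m + k + 3 + 2 by ring, ih, chain]

theorem represents_column_zero :
    Represents 1 (TM0.init (a :: b :: List.replicate k c) : TM0.Cfg Γ Λ)
      (column M a b c k 0) (k + 1) := by
  have hl : ∀ i, (sides (TM0.init (a :: b :: List.replicate k c) : TM0.Cfg Γ Λ).Tape i) =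
      (default, (b :: List.replicate k c).getI i) := by
    intro i
    simp only [sides, TM0.init, Tape.mk₁, Tape.mk₂, Tape.mk', ListBlank.tail_mk, ListBlank.nth_mk]
    simp
  have hd : ∀ i, k ≤ i → (b :: List.replicate k c).getI (i + 1) = default := by
    intro i hi
    exact List.getI_eq_default _ (by simpa using hi)
  refine ⟨by omega, ⟨none, default, default, ?_⟩, fun i hi => ?_, fun i hi => ⟨?_, ?_⟩⟩
  · rw [column_zero_of_le _ (by omega)]
    rfl
  · rw [hl]
    rcases i with _ | i
    · refine ⟨_, _, _, _, column_zero_of_le _ (by omega), ?_⟩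
      simp
    rcases Nat.lt_or_ge i k with h | h
    · refine ⟨none, default, default, 0, ?_, by simp; omega⟩
      rw [column_zero_of_le _ (by omega), List.getI_cons_succ,
        List.getI_eq_getElem _ (by simpa using h)]
      simp [start]
    · obtain rfl : i = k := by omega
      exact ⟨none, default, default, 3, by rw [column_zero_last, hd _ le_rfl]; rfl, by simp⟩
  · obtain ⟨m, rfl⟩ : ∃ m, i = m + (k + 2) := ⟨i - (k + 2), by omega⟩
    exact column_zero_of_gt m
  · obtain ⟨m, rfl⟩ : ∃ m, i = m + 1 := ⟨i - 1, by omega⟩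
    rw [hl, hd _ (by omega)]
    rfl

theorem exists_represents_of_reaches {cfg : TM0.Cfg Γ Λ}
    (h : StateTransition.Reaches (TM0.step M) (TM0.init (a :: b :: List.replicate k c)) cfg) :
    ∃ (t E : ℕ) (x : ZMod 3), Represents x cfg (column M a b c k t) E ∧
      ∀ s ≤ t, ∃ B, ∀ m, B ≤ m → column M a b c k s m = zero := by
  induction h with
  | refl =>
    refine ⟨0, _, _, represents_column_zero, fun s hs => ?_⟩
    obtain rfl : s = 0 := by omega
    exact represents_column_zero.eventually_zero
  | tail _ hs ih =>
    obtain ⟨t, E, x, H, hz⟩ := ih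
    have H' := H.step hs (column_succ_zero t) (column_succ_succ t)
    refine ⟨t + 1, _, _, H', fun s hs => ?_⟩
    rcases Nat.lt_or_ge t s with h | h
    · obtain rfl : s = t + 1 := by omega
      exact H'.eventually_zero
    · exact hz s h

/-- As the number of columns that are not zero is finite, the bounds for them can be combined. -/
theorem system_ultimatelyZero_of_column
    (h : ∀ s, ∃ B, ∀ m, B ≤ m → column M a b c k s m = zero) {T : ℕ}
    (hT : ∀ s, T ≤ s → ∀ m, column M a b c k s m = zero) :
    (system M a b c k).UltimatelyZero := by
  choose B hB using h
  have hS : (system M a b c k).IsSymmetric := fun u v => table_comm u v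
  refine ⟨2 * T + (Finset.range T).sup B, ?_⟩
  have key : ∀ i j, 0 < i → i ≤ j → 2 * T + (Finset.range T).sup B < i + j →
      (system M a b c k).development i j = .inl zero := by
    intro i j hi hij hN
    obtain ⟨s, rfl⟩ : ∃ s, i = s + 1 := ⟨i - 1, by omega⟩
    obtain ⟨m, rfl⟩ : ∃ m, j = s + 1 + m := ⟨j - (s + 1), by omega⟩
    refine proj_eq_zero (a := a) (b := b) (c := c) |>.1 ?_
    change column M a b c k s m = zero
    rcases Nat.lt_or_ge s T with h | h
    · have := Finset.le_sup (f := B) (Finset.mem_range.2 h)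
      exact hB s m (by omega)
    · exact hT s h m
  intro i j hi hj hN
  rcases le_total i j with h | h
  · exact key i j hi h hN
  · rw [hS.development_comm]
    exact key j i hj h (by omega)

theorem system_ultimatelyZero_of_dom
    (h : (TM0.eval M (a :: b :: List.replicate k c)).Dom) :
    (system M a b c k).UltimatelyZero := by
  rw [TM0.eval, Part.map_Dom, Part.dom_iff_mem] at h
  obtain ⟨cfg, h⟩ := h
  obtain ⟨hr, hs⟩ := StateTransition.mem_eval.1 h
  obtain ⟨t, E, x, H, hz⟩ := exists_represents_of_reaches hr
  -- The column `t + 2` consists of `kill` symbols, and the following ones are zero.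
  obtain ⟨h1, h2⟩ := H.halt hs (column_succ_zero t) (column_succ_succ t)
  have h3 : ∀ s m, column M a b c k (s + (t + 2)) m = zero := by
    intro s
    induction s with
    | zero =>
      intro m
      rw [zero_add]
      induction m with
      | zero => rw [column_succ_zero, h1 1 (by omega)]; rfl
      | succ m ih =>
        rw [column_succ_succ, ih]
        rcases Nat.lt_or_ge (E + 1) (m + 2) with hm | hm
        · rw [h2 _ hm, rule_zero_zero]
        · rw [h1 _ hm]
          exact rule_eq_zero M (by simp) rfl rfl
    | succ s ih =>
      intro m
      rw [show s + 1 + (t + 2) = s + (t + 2) + 1 by ring]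
      induction m with
      | zero => rw [column_succ_zero, ih]; rfl
      | succ m ihm => rw [column_succ_succ, ih, ihm, rule_zero_zero]
  have h4 : ∀ s, t + 2 ≤ s → ∀ m, column M a b c k s m = zero := by
    intro s hs
    obtain ⟨s, rfl⟩ : ∃ r, s = r + (t + 2) := ⟨s - (t + 2), by omega⟩
    exact h3 s
  refine system_ultimatelyZero_of_column (fun s => ?_) h4
  rcases Nat.lt_trichotomy s (t + 1) with h | rfl | h
  · exact hz s (by omega)
  · exact ⟨E + 2, fun m hm => h2 m (by omega)⟩
  · exact ⟨0, fun m _ => h4 s (by omega) m⟩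

theorem dom_of_system_ultimatelyZero (h : (system M a b c k).UltimatelyZero) :
    (TM0.eval M (a :: b :: List.replicate k c)).Dom := by
  by_contra hd
  have key : ∀ t, ∃ (cfg : TM0.Cfg Γ Λ) (E : ℕ) (x : ZMod 3),
      StateTransition.Reaches (TM0.step M) (TM0.init (a :: b :: List.replicate k c)) cfg ∧
      Represents x cfg (column M a b c k t) E := by
    intro t
    induction t with
    | zero => exact ⟨_, _, _, .refl, represents_column_zero⟩
    | succ t ih =>
      obtain ⟨cfg, E, x, hr, H⟩ := ih
      rcases hs : TM0.step M cfg with _ | cfg'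
      · refine absurd ?_ hd
        rw [TM0.eval, Part.map_Dom, Part.dom_iff_mem]
        exact ⟨cfg, StateTransition.mem_eval.2 ⟨hr, hs⟩⟩
      · exact ⟨cfg', _, _, hr.tail hs, H.step hs (column_succ_zero t) (column_succ_succ t)⟩
  obtain ⟨N, hN⟩ := h
  obtain ⟨cfg, E, x, _, H⟩ := key N
  obtain ⟨_, _, _, hw⟩ := H.head
  have := hN (N + 1) (N + 1 + 1) (by omega) (by omega) (by omega)
  rw [column, this] at hw
  simp [system, proj] at hw

theorem system_ultimatelyZero_iff : (system M a b c k).UltimatelyZero ↔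
    (TM0.eval M (a :: b :: List.replicate k c)).Dom :=
  ⟨dom_of_system_ultimatelyZero, system_ultimatelyZero_of_dom⟩

end development

/-! ### Numbering the carrier, and computability of the table -/

section numbering

variable {Γ Λ : Type}

/-- The numbering of the carrier: first the symbols, then the counting symbols. -/
def number {K : ℕ} (σ : GridSymbol Γ Λ ≃ Fin K) : GridSymbol Γ Λ ⊕ ℕ ≃ ℕ :=
  (σ.sumCongr (Equiv.refl ℕ)).trans (finSumNatEquiv K)

theorem primrec_number [Primcodable (GridSymbol Γ Λ)] {K : ℕ} (σ : GridSymbol Γ Λ ≃ Fin K) :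
    Primrec (number σ) := by
  have : Finite (GridSymbol Γ Λ) := Finite.of_equiv _ σ.symm
  refine (Primrec.sumCasesOn (f := id) (g := fun _ x => (σ x : ℕ)) (h := fun _ i => K + i) .id
    ((Primrec.dom_finite fun x => (σ x : ℕ)).comp₂ .right)
    (Primrec.nat_add.comp₂ (.const K) .right)).of_eq ?_
  rintro (x | i) <;> simp [number]

theorem primrec_number_symm [Primcodable (GridSymbol Γ Λ)] {K : ℕ} (σ : GridSymbol Γ Λ ≃ Fin K) :
    Primrec (number σ).symm := by
  refine (Primrec.ite (c := fun n : ℕ => n < K)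
    (f := fun n => Sum.inl ((List.ofFn σ.symm).getD n zero))
    (g := fun n => Sum.inr (n - K)) (Primrec.nat_lt.comp .id (.const K))
    (Primrec.sumInl.comp ((Primrec.list_getD zero).comp (.const _) .id))
    (Primrec.sumInr.comp (Primrec.nat_sub.comp .id (.const K)))).of_eq fun n => ?_
  by_cases h : n < K
  · simp [number, h]
  · simp [number, h, Nat.le_of_not_lt h]

variable [Inhabited Γ]

theorem primrec_chain [Primcodable (GridSymbol Γ Λ)] :
    Primrec₂ (chain : ℕ → GridSymbol Γ Λ ⊕ ℕ → GridSymbol Γ Λ ⊕ ℕ) := by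
  refine (Primrec.sumCasesOn (f := fun p : ℕ × (GridSymbol Γ Λ ⊕ ℕ) => p.2)
    (g := fun _ _ => (Sum.inl zero : GridSymbol Γ Λ ⊕ ℕ))
    (h := fun p i => if i < p.1 + 2 then Sum.inr (i + 1) else
      Sum.inl (cell 1 none default default default 3)) .snd (Primrec₂.const _) ?_).of_eq ?_
  · refine Primrec.ite (c := fun q : (ℕ × (GridSymbol Γ Λ ⊕ ℕ)) × ℕ => q.2 < q.1.1 + 2) ?_ ?_ ?_
    · exact Primrec.nat_lt.comp .snd (Primrec.nat_add.comp (Primrec.fst.comp .fst) (.const 2))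
    · exact Primrec.sumInr.comp (Primrec.succ.comp .snd)
    · exact .const _
  · rintro ⟨k, x | i⟩ <;> simp [chain]

variable [Inhabited Λ] {M : TM0.Machine Γ Λ} {a b c : Γ} {k : ℕ}

theorem number_table_lt {K : ℕ} (σ : GridSymbol Γ Λ ≃ Fin K) (u v : GridSymbol Γ Λ ⊕ ℕ) :
    number σ (table M a b c k u v) < K + (k + 3) := by
  have hl : ∀ x, number σ (.inl x) < K + (k + 3) := fun x => by
    have := (σ x).isLt
    simp [number]
    omega
  have hc : ∀ w : GridSymbol Γ Λ ⊕ ℕ, number σ (chain k w) < K + (k + 3) := by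
    rintro (w | i)
    · exact hl _
    · rw [chain]
      split_ifs with h
      · simp [number]
        omega
      · exact hl _
  unfold table
  split_ifs
  · simp [number]
  · exact hc _
  · exact hc _
  · exact hl _

/-- The simulating system on `{0, …, K + k + 2}`, where `K` is the number of symbols. -/
noncomputable def finiteSystem (M : TM0.Machine Γ Λ) (a b c : Γ) {K : ℕ}
    (σ : GridSymbol Γ Λ ≃ Fin K) (k : ℕ) : FiniteDoubleRecSystem where
  fst := K + (k + 3)
  snd :=
    { f := fun x y => ⟨number σ (table M a b c k ((number σ).symm x) ((number σ).symm y)),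
        number_table_lt σ _ _⟩
      zero := Fin.castAdd _ (σ zero)
      one := Fin.castAdd _ (σ one) }

theorem finiteSystem_isSymmetric {K : ℕ} (σ : GridSymbol Γ Λ ≃ Fin K) :
    (finiteSystem M a b c σ k).2.IsSymmetric := fun x y => by
  simp only [finiteSystem, table_comm]

theorem finiteSystem_ultimatelyZero_iff {K : ℕ} (σ : GridSymbol Γ Λ ≃ Fin K) :
    (finiteSystem M a b c σ k).2.UltimatelyZero ↔
      (TM0.eval M (a :: b :: List.replicate k c)).Dom := by
  rw [← system_ultimatelyZero_iff]
  refine (DoubleRecSystem.ultimatelyZero_hom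
    (fun x : Fin (K + (k + 3)) => (number σ).symm (x : ℕ)) ?_ ?_ ?_ ?_).symm
  · exact (number σ).symm.injective.comp Fin.val_injective
  · exact (number σ).symm_apply_eq.2 (by simp [number, finiteSystem, system])
  · exact (number σ).symm_apply_eq.2 (by simp [number, finiteSystem, system])
  · intro x y
    simp [finiteSystem, system]

section computability

variable [Primcodable (GridSymbol Γ Λ)]

theorem primrec_start : Primrec (start a b c : ℕ → GridSymbol Γ Λ) :=
  ((Primrec.list_getD (start a b c 3)).comp (.const [start a b c 0, start a b c 1, start a b c 2])
    .id).of_eq fun i => by rcases i with _ | _ | _ | i <;> rfl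

theorem primrec_table [Finite Γ] [Finite Λ] :
    Primrec fun p : ℕ × (GridSymbol Γ Λ ⊕ ℕ) × (GridSymbol Γ Λ ⊕ ℕ) =>
      table M a b c p.1 p.2.1 p.2.2 := by
  have hproj : Primrec (proj a b c : GridSymbol Γ Λ ⊕ ℕ → GridSymbol Γ Λ) := by
    refine (Primrec.sumCasesOn (f := id) .id .right
      ((primrec_start (a := a) (b := b) (c := c)).comp₂ .right)).of_eq ?_
    rintro (x | i) <;> rfl
  -- The machine enters only through this finite table.
  have hrule : Primrec₂ (rule M) := Primrec.dom_finite _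
  classical
  have hone : PrimrecPred fun u : GridSymbol Γ Λ ⊕ ℕ => u = .inl one :=
    Primrec.eq.comp .id (.const _)
  have hu : Primrec fun p : ℕ × (GridSymbol Γ Λ ⊕ ℕ) × (GridSymbol Γ Λ ⊕ ℕ) => p.2.1 :=
    Primrec.fst.comp .snd
  have hv : Primrec fun p : ℕ × (GridSymbol Γ Λ ⊕ ℕ) × (GridSymbol Γ Λ ⊕ ℕ) => p.2.2 :=
    Primrec.snd.comp .snd
  refine (Primrec.ite (hone.comp hu)
    (Primrec.ite (hone.comp hv) (.const (.inr 0)) (primrec_chain.comp .fst hv))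
    (Primrec.ite (hone.comp hv) (primrec_chain.comp .fst hu)
      (Primrec.sumInl.comp (hrule.comp (hproj.comp hu) (hproj.comp hv))))).of_eq fun p => ?_
  unfold table
  split_ifs <;> rfl

theorem primrec_code [Finite Γ] [Finite Λ] {K : ℕ} (σ : GridSymbol Γ Λ ≃ Fin K) :
    Primrec fun k => FiniteDoubleRecSystem.code (finiteSystem M a b c σ k) := by
  have hn : Primrec fun k : ℕ => List.range (K + (k + 3)) :=
    Primrec.list_range.comp (Primrec.nat_add.comp (.const K) (Primrec.nat_add.comp .id (.const 3)))
  refine (Primrec.pair (Primrec.list_map hn (g := fun k x => (List.range (K + (k + 3))).map fun y =>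
    number σ (table M a b c k ((number σ).symm x) ((number σ).symm y))) ?_)
    (.const ((σ zero : ℕ), (σ one : ℕ)))).of_eq fun k => ?_
  · refine Primrec.list_map (hn.comp .fst) ?_
    exact (primrec_number σ).comp (primrec_table.comp (Primrec.pair (Primrec.fst.comp .fst)
      (Primrec.pair ((primrec_number_symm σ).comp (Primrec.snd.comp .fst))
        ((primrec_number_symm σ).comp .snd))))
  · refine Prod.ext ?_ rfl
    simp only [FiniteDoubleRecSystem.code, finiteSystem, ← List.map_coe_finRange_eq_range,
      List.map_map, List.ofFn_eq_map]
    rfl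

end computability

end numbering

end GridSymbol

/-! ### The reduction -/

/-- A computable many-one reduction from a set of numbers to an algorithmically solvable problem. -/
theorem AlgorithmicallySolvable.computablePred {I α : Type*} [Primcodable α] {code : I → α}
    {P : I → Prop} (h : AlgorithmicallySolvable code P) (r : ℕ → I)
    (hr : Computable fun k => code (r k)) : ComputablePred fun k => P (r k) := by
  obtain ⟨d, hd, h⟩ := h
  choose b hb hP using fun k => h (r k)
  have : Computable b := (hd.comp hr).of_eq fun k => Part.eq_some_iff.2 (hb k)
  exact ComputablePred.computable_iff.2 ⟨b, this, funext fun k => propext (hP k).symm⟩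

theorem not_suwSolvable : ¬ SUWSolvable := by
  intro h
  obtain ⟨Γ, Λ₀, _, _, _, M₀, S, a, b, c, hS, hM₀⟩ := exists_TM0_undecidable
  obtain ⟨Λ, _, _, M, hM⟩ := TM0.exists_finite_machine M₀ S hS
  obtain ⟨K, ⟨σ⟩⟩ := Finite.exists_equiv_fin (GridSymbol Γ Λ)
  let _ : Primcodable (GridSymbol Γ Λ) := Primcodable.ofEquiv _ σ
  refine hM₀ ((h.computablePred (fun k => ⟨GridSymbol.finiteSystem M a b c σ k,
    GridSymbol.finiteSystem_isSymmetric σ⟩) (GridSymbol.primrec_code σ).to_comp).of_eq fun k => ?_)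
  rw [← hM]
  exact GridSymbol.finiteSystem_ultimatelyZero_iff σ

theorem UWSolvable.suwSolvable (h : UWSolvable) : SUWSolvable := by
  obtain ⟨d, hd, h⟩ := h
  exact ⟨d, hd, fun S => h S.1⟩

theorem theorem1p4 : ¬ UWSolvable ∧ ¬ SUWSolvable :=
  ⟨fun h => not_suwSolvable h.suwSolvable, not_suwSolvable⟩
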